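/- **Theorem 1.9 (Fixed Proportion Decomposition Model).** For $x>0$ let $S(x)\in[1,10)$ be its base-10 significand, i.e. $x=S(x)\,10^{k}$ with $k\in\mathbb Z$. Let $p\in(0,1)$ and $L>0$. Start with one stick of length $L$; at each of $N$ stages cut every stick of length $x$ into two sticks of lengths $xp$ and $x(1-p)$. For $s\in[1,10)$ let $P_N(s)$ be the proportion of the sticks present after $N$ stages, counted with multiplicity, whose length has significand at most $s$. Define $y\in\mathbb R$ by $10^y=(1-p)/p$. 1. After $N$ stages there are $2^N$ sticks: for each $0\le n\le N$ the process contributes $\binom Nn$ sticks of length $Lp^{N-n}(1-p)^n$. If $p\ne\frac12$ these $N+1$ lengths are distinct, and the length $Lp^{N-n}(1-p)^n$ occurs with frequency $\binom Nn/2^N$. The ratio of adjacent lengths is $\dfrac{Lp^{N-n-1}(1-p)^{n+1}}{Lp^{N-n}(1-p)^{n}}=10^y$ for $0\le n<N$. 2. The stick lengths converge in distribution to Benford's law, that is, $\lim_{N\to\infty}P_N(s)=\log_{10}s$ for every $s\in[1,10)$, if and only if $y\notin\mathbb Q$. 3. Suppose that $y$ has finite irrationality exponent $\kappa$, where the irrationality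 exponent of $y$ is the supremum of all real $\gamma$ with $\liminf_{q\to\infty}q^{\gamma+1}\min_{m\in\mathbb Z}\left|y-\frac mq\right|=0$. Then $\kappa\ge1$, and the convergence has a power saving: for every $\eta$ with $0<\eta<\frac{1}{2(\kappa+1)}$ there is a constant $C$ (depending only on $p$, $L$ and $\eta$) such that $$\left|P_N(s)-\log_{10}s\right|\le C\,N^{-\eta}\qquad\text{for all }N\ge1\text{ and all }s\in[1,10).$$ -/

import Mathlib

open Filter Topology

noncomputable section

/-- The significand of `x > 0` in base 10: the number `S` in `[1, 10)` such that
`x = S * 10 ^ k` with `k` an integer. -/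
def significand (x : ℝ) : ℝ := x / (10 : ℝ) ^ ⌊Real.logb 10 x⌋

/-- The indicator function of the event that the significand is at most `s`. -/
def significandIndicator (s x : ℝ) : ℝ := if significand x ≤ s then 1 else 0

/-- The lengths, with multiplicity, of the sticks obtained from one stick of length `L` after `N`
stages, where at each stage every stick is cut at the fixed proportion `p`. -/
def stickLengths (p L : ℝ) : ℕ → Multiset ℝ
  | 0 => {L}
  | N + 1 => (stickLengths p L N).bind fun x => {x * p, x * (1 - p)}

/-- The length `L * p ^ (N - n) * (1 - p) ^ n`, for `0 ≤ n ≤ N`. -/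
def pieceLength (p L : ℝ) (N n : ℕ) : ℝ := L * p ^ (N - n) * (1 - p) ^ n

/-- The proportion of the members of a finite family of lengths whose significand is at
most `s`. -/
def significandProportion (X : Multiset ℝ) (s : ℝ) : ℝ :=
  (X.map (significandIndicator s)).sum / (X.card : ℝ)

/-- A sequence of finite families of lengths converges in distribution to Benford's law (base 10):
the distribution functions of the significands converge pointwise to `s ↦ log₁₀ s` on `[1, 10)`.
Outside of that interval all the distribution functions in question agree. -/
def ConvergesToBenford (X : ℕ → Multiset ℝ) : Prop :=
  ∀ s ∈ Set.Ico (1 : ℝ) 10,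
    Tendsto (fun N => significandProportion (X N) s) atTop (𝓝 (Real.logb 10 s))

/-- `κ` is the irrationality exponent of `α`: the supremum of the real numbers `γ` with
`liminf_{q → ∞} q ^ (γ + 1) * min_m |α - m / q| = 0`. In this normalization almost every number has
exponent `1`. The lower limit is taken in `[0, ∞]`, where it always exists. A number for which the
set of such `γ` is unbounded (for instance a rational one) has no (finite) exponent. -/
def HasIrrationalityExponent (α κ : ℝ) : Prop :=
  IsLUB {γ : ℝ | liminf (fun q : ℕ =>
    ENNReal.ofReal ((q : ℝ) ^ (γ + 1) * ⨅ m : ℤ, |α - (m : ℝ) / (q : ℝ)|)) atTop = 0} κ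

end

/-!
After `N` stages the logarithms of the stick lengths are `x + n * y` for `0 ≤ n ≤ N`, where
`x = log₁₀ (L * p ^ N)`, and `x + n * y` carries the binomial mass `N.choose n / 2 ^ N`. So the
proportion of significands at most `s` is the value at `t = log₁₀ s` of the distribution function
`binomialFractCDF N x y` of the fractional parts, and everything rests on one estimate,
`abs_binomialFractCDF_sub_le`: if `a / q` is a reduced fraction with `|y - a / q| ≤ 1 / q ^ 2`, then
`|binomialFractCDF N x y t - t| ≤ 5 / q + 2 * q / √N`, uniformly in `x` and `t`.

For this, the `q` consecutive points `x + j * y` are within `1 / q` of the translates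
`x + j * a / q`, which are equally spaced modulo `1`, so `q * t` of them, up to an error of `5`, have
fractional part at most `t` (`abs_card_filter_fract_le_sub_le`). The binomial weights are unimodal,
so their total variation is twice the central weight, which is at most `1 / √N`; hence shifting the
indices by `j < q` changes a weighted sum of numbers in `[0, 1]` by at most `2 * q / √N`
(`abs_sum_shift_sub_sum_le`). Averaging over the shifts `j < q` replaces the indicator of
`fract (x + n * y) ≤ t` by its averages over `q` consecutive points.

If `y` is irrational, it has such approximations with `q` arbitrarily large, so the distribution
functions converge to the identity. If `y` has denominator `b`, any two of the fractional parts are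
equal or at least `1 / b` apart, so that the intervals `(0, 1 / (3 * b)]` and
`(1 / (3 * b), 2 / (3 * b)]` are never both charged (`not_tendsto_binomialFractCDF`).

If the irrationality exponent is `κ` and `κ' > κ`, then `|y - m / q| ≥ c / q ^ (κ' + 1)` for all `q`
(`exists_le_rpow_mul_abs_sub`). Let `2 * η * (κ' + 1) = 1`. Dirichlet's theorem with the bound
`N ^ (κ' * η)` for the denominator gives `q ≤ N ^ (κ' * η) = N ^ (1 / 2 - η)`, while the lower bound
for `|y - a / q|` forces `q` to be at least a constant times `N ^ η`; both error terms are then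
`O(N ^ (-η))` (`exists_binomialFractCDF_rate`).
-/

/-! ### Total variation of the binomial weights -/

/-- Shifting the arguments of a `[0, 1]`-valued function by one changes its sum against a weight by
at most the total variation of the weight, extended by zero outside of `[0, N]`. -/
theorem abs_sum_shift_sub_sum_le (w g : ℕ → ℝ) (N : ℕ) (hw0 : 0 ≤ w 0) (hwN : w (N + 1) = 0)
    (hg0 : ∀ n, 0 ≤ g n) (hg1 : ∀ n, g n ≤ 1) :
    |∑ n ∈ Finset.range (N + 1), w n * g (n + 1) - ∑ n ∈ Finset.range (N + 1), w n * g n| ≤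
      w 0 + ∑ n ∈ Finset.range (N + 1), |w n - w (n + 1)| := by
  have h1 : ∑ n ∈ Finset.range (N + 1), w n * g n
      = ∑ n ∈ Finset.range (N + 1), w (n + 1) * g (n + 1) + w 0 * g 0 := by
    have := Finset.sum_range_succ (fun n => w n * g n) (N + 1)
    rw [Finset.sum_range_succ'] at this
    simp only [hwN, zero_mul, add_zero] at this
    exact this.symm
  have h2 : ∑ n ∈ Finset.range (N + 1), w n * g (n + 1) - ∑ n ∈ Finset.range (N + 1), w n * g n
      = ∑ n ∈ Finset.range (N + 1), (w n - w (n + 1)) * g (n + 1) - w 0 * g 0 := by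
    rw [h1]; simp only [sub_mul, Finset.sum_sub_distrib]; ring
  rw [h2]
  have habs : ∀ n, |g n| ≤ 1 := fun n => abs_le.2 ⟨by linarith [hg0 n], hg1 n⟩
  have h3 : |∑ n ∈ Finset.range (N + 1), (w n - w (n + 1)) * g (n + 1)|
      ≤ ∑ n ∈ Finset.range (N + 1), |w n - w (n + 1)| := by
    refine (Finset.abs_sum_le_sum_abs _ _).trans (Finset.sum_le_sum fun n _ => ?_)
    rw [abs_mul]
    exact mul_le_of_le_one_right (abs_nonneg _) (habs _)
  have h4 : |w 0 * g 0| ≤ w 0 := by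
    rw [abs_mul, abs_of_nonneg hw0]
    exact mul_le_of_le_one_right hw0 (habs _)
  linarith [abs_sub (∑ n ∈ Finset.range (N + 1), (w n - w (n + 1)) * g (n + 1)) (w 0 * g 0)]

theorem centralBinom_sq_mul_le (m : ℕ) :
    (m.centralBinom : ℝ) ^ 2 * (2 * m + 1) ≤ (2 ^ (2 * m)) ^ 2 := by
  induction m with
  | zero => simp
  | succ m ih =>
    have h : ((m : ℝ) + 1) * (m + 1).centralBinom = 2 * (2 * m + 1) * m.centralBinom := by
      exact_mod_cast Nat.succ_mul_centralBinom_succ m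
    have hm : (0 : ℝ) < (m + 1) ^ 2 := by positivity
    refine le_of_mul_le_mul_left ?_ hm
    have e1 : ((m : ℝ) + 1) ^ 2 * (((m + 1).centralBinom : ℝ) ^ 2 * (2 * (m + 1 : ℕ) + 1))
        = 4 * (2 * m + 1) * (2 * m + 3) * ((m.centralBinom : ℝ) ^ 2 * (2 * m + 1)) := by
      have := congrArg (fun z => z ^ 2 * (2 * (m : ℝ) + 3)) h
      push_cast
      linear_combination this
    rw [e1]
    calc _ ≤ 4 * (2 * (m : ℝ) + 1) * (2 * m + 3) * (2 ^ (2 * m)) ^ 2 := by gcongr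
      _ ≤ 16 * ((m : ℝ) + 1) ^ 2 * (2 ^ (2 * m)) ^ 2 :=
          mul_le_mul_of_nonneg_right (by nlinarith) (by positivity)
      _ = _ := by ring

theorem choose_half_div_two_pow_le {N : ℕ} (hN : 1 ≤ N) :
    ((N.choose (N / 2) : ℝ) / 2 ^ N) ≤ 1 / √(N : ℝ) := by
  have hN' : (0 : ℝ) < N := by exact_mod_cast hN
  have key : (N.choose (N / 2) : ℝ) ^ 2 * N ≤ (2 ^ N) ^ 2 := by
    rcases Nat.even_or_odd' N with ⟨m, rfl | rfl⟩
    · have := centralBinom_sq_mul_le m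
      rw [Nat.mul_div_cancel_left _ two_pos, ← Nat.centralBinom_eq_two_mul_choose]
      push_cast
      nlinarith [sq_nonneg (m.centralBinom : ℝ)]
    · have h := centralBinom_sq_mul_le (m + 1)
      have e : (m + 1).centralBinom = 2 * (2 * m + 1).choose m := by
        rw [Nat.centralBinom_eq_two_mul_choose, show 2 * (m + 1) = 2 * m + 1 + 1 by ring,
          Nat.choose_succ_succ, ← Nat.choose_symm_half m]
        ring
      have e2 : (2 * m + 1) / 2 = m := by omega
      rw [e] at h
      rw [e2]
      push_cast at h ⊢
      have e3 : ((2 : ℝ) ^ (2 * (m + 1))) ^ 2 = 4 * (2 ^ (2 * m + 1)) ^ 2 := by ring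
      rw [e3] at h
      nlinarith [sq_nonneg ((2 * m + 1).choose m : ℝ)]
  rw [div_le_div_iff₀ (by positivity) (by positivity), one_mul]
  refine abs_le_of_sq_le_sq' ?_ (by positivity) |>.2
  rwa [mul_pow, Real.sq_sqrt hN'.le]

/-- The total variation of a row of Pascal's triangle, extended by zero on both sides: by
unimodality it is twice the central entry. -/
theorem choose_zero_add_sum_abs_sub (N : ℕ) :
    (N.choose 0 : ℝ) + ∑ n ∈ Finset.range (N + 1), |(N.choose n : ℝ) - N.choose (n + 1)|
      = 2 * N.choose (N / 2) := by
  have hsplit := Finset.sum_range_add_sum_Ico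
    (fun n => |(N.choose n : ℝ) - N.choose (n + 1)|) (show N / 2 ≤ N + 1 by omega)
  have h1 : ∑ n ∈ Finset.range (N / 2), |(N.choose n : ℝ) - N.choose (n + 1)|
      = N.choose (N / 2) - N.choose 0 := by
    rw [← Finset.sum_range_sub (fun n => (N.choose n : ℝ))]
    refine Finset.sum_congr rfl fun n hn => ?_
    have : N.choose n ≤ N.choose (n + 1) :=
      Nat.choose_le_succ_of_lt_half_left (Finset.mem_range.1 hn)
    rw [abs_sub_comm, abs_of_nonneg]
    exact sub_nonneg.2 (by exact_mod_cast this)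
  have h2 : ∑ n ∈ Finset.Ico (N / 2) (N + 1), |(N.choose n : ℝ) - N.choose (n + 1)|
      = N.choose (N / 2) := by
    have : ∑ n ∈ Finset.Ico (N / 2) (N + 1), |(N.choose n : ℝ) - N.choose (n + 1)|
      = -∑ n ∈ Finset.Ico (N / 2) (N + 1), ((N.choose (n + 1) : ℝ) - N.choose n) := by
      rw [← Finset.sum_neg_distrib]
      refine Finset.sum_congr rfl fun n hn => ?_
      rw [Finset.mem_Ico] at hn
      have : N.choose (n + 1) ≤ N.choose n := by
        rcases Nat.lt_or_ge N (n + 1) with h | h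
        · rw [Nat.choose_eq_zero_of_lt h]; exact Nat.zero_le _
        · rcases eq_or_ne (N / 2) (N - (n + 1)) with h3 | h3
          · rw [← Nat.choose_symm h, ← h3]
            have : N - n = N / 2 + 1 := by omega
            have h4 : n = N / 2 := by omega
            rw [h4]
          · have h5 := Nat.choose_le_succ_of_lt_half_left
              (show N - (n + 1) < N / 2 by omega)
            rw [show N - (n + 1) + 1 = N - n by omega, Nat.choose_symm h,
              Nat.choose_symm (by omega)] at h5
            exact h5
      rw [abs_of_nonneg (sub_nonneg.2 (by exact_mod_cast this))]
      ring
    rw [this, Finset.sum_Ico_sub (fun n => (N.choose n : ℝ)) (by omega)]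
    simp
  linarith

/-! ### Blocks of consecutive multiples of a number close to a reduced fraction -/

/-- If the labels `c j` are distinct for `j < q` and the labels of the `j` satisfying `P` lie in
`[u, v]`, with the possible exceptions `0` and `q - 1`, then at most `v - u + 3` of the `j` satisfy
`P`. -/
theorem card_filter_le_of_residue {q : ℕ} (c : ℕ → ℤ)
    (hc : Set.InjOn c (Finset.range q)) (P : ℕ → Prop) [DecidablePred P] (u v : ℝ) (huv : u ≤ v)
    (h : ∀ j < q, P j → (u ≤ c j ∧ (c j : ℝ) ≤ v) ∨ c j = 0 ∨ c j = q - 1) :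
    (((Finset.range q).filter P).card : ℝ) ≤ v - u + 3 := by
  classical
  have h1 : ((Finset.range q).filter P).card
      ≤ (Finset.Icc ⌈u⌉ ⌊v⌋ ∪ {0, (q : ℤ) - 1}).card := by
    refine Finset.card_le_card_of_injOn c (fun j hj => ?_) (hc.mono fun j hj => ?_)
    · simp only [Finset.coe_filter, Finset.mem_range, Set.mem_ofPred_eq] at hj
      rcases h j hj.1 hj.2 with h | h | h
      · simp [Int.ceil_le, Int.le_floor, h.1, h.2]
      · simp [h]
      · simp [h]
    · simp only [Finset.coe_filter, Set.mem_ofPred_eq] at hj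
      exact hj.1
  have h2 : (Finset.Icc ⌈u⌉ ⌊v⌋ ∪ {0, (q : ℤ) - 1}).card ≤ (⌊v⌋ + 1 - ⌈u⌉).toNat + 2 := by
    refine (Finset.card_union_le _ _).trans ?_
    rw [Int.card_Icc]
    gcongr
    exact Finset.card_le_two
  have h3 : (((⌊v⌋ + 1 - ⌈u⌉).toNat : ℕ) : ℝ) ≤ v - u + 1 := by
    rcases le_total 0 (⌊v⌋ + 1 - ⌈u⌉) with h0 | h0
    · have : (((⌊v⌋ + 1 - ⌈u⌉).toNat : ℤ) : ℝ) = ((⌊v⌋ + 1 - ⌈u⌉ : ℤ) : ℝ) := by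
        rw [Int.toNat_of_nonneg h0]
      rw [Int.cast_natCast] at this
      rw [this]; push_cast
      linarith [Int.floor_le v, Int.le_ceil u]
    · rw [Int.toNat_of_nonpos h0]; simp; linarith
  have h4 : (((Finset.range q).filter P).card : ℝ) ≤ ((⌊v⌋ + 1 - ⌈u⌉).toNat : ℕ) + 2 := by
    exact_mod_cast h1.trans h2
  linarith

theorem injOn_emod {a : ℤ} {q : ℕ} (haq : IsCoprime a (q : ℤ)) (b : ℤ) :
    Set.InjOn (fun j : ℕ => (b + j * a) % (q : ℤ)) (Finset.range q) := by
  intro i hi j hj hij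
  simp only [Finset.coe_range, Set.mem_Iio] at hi hj
  have h1 : (q : ℤ) ∣ ((j : ℤ) - i) * a := by
    have := Int.ModEq.dvd (show (b + i * a) ≡ (b + j * a) [ZMOD q] from hij)
    convert this using 1; ring
  have h2 : (q : ℤ) ∣ (j : ℤ) - i := haq.symm.dvd_of_dvd_mul_right h1
  have h3 := Int.eq_zero_of_abs_lt_dvd h2 (by rw [abs_lt]; omega)
  omega

/-- Among `q` consecutive terms of `x + j * y`, about `q * t` have fractional part at most `t`, if `y`
is within `1 / q ^ 2` of a reduced fraction with denominator `q`. -/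
theorem abs_card_filter_fract_le_sub_le {y : ℝ} {a : ℤ} {q : ℕ} (hq : 0 < q)
    (haq : IsCoprime a (q : ℤ)) (hy : |y - a / q| ≤ 1 / (q : ℝ) ^ 2) (x : ℝ) {t : ℝ}
    (ht : t ∈ Set.Ico (0 : ℝ) 1) :
    |(((Finset.range q).filter fun j : ℕ => Int.fract (x + j * y) ≤ t).card : ℝ) - q * t| ≤ 5 := by
  have hq' : (0 : ℝ) < q := by exact_mod_cast hq
  set b : ℤ := ⌊q * x⌋ with hb
  -- `c j / q` approximates the fractional part of `x + j * y`, modulo `1`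
  set c : ℕ → ℤ := fun j => (b + j * a) % (q : ℤ) with hc
  have hinj : Set.InjOn c (Finset.range q) := injOn_emod haq b
  have hc0 : ∀ j, 0 ≤ c j := fun j => Int.emod_nonneg _ (by omega)
  have hcq : ∀ j, c j < q := fun j => Int.emod_lt_of_pos _ (by omega)
  have hdiv : ∀ j : ℕ, ((c j : ℤ) : ℝ) = b + j * a - q * ((b + j * a) / (q : ℤ) : ℤ) := by
    intro j
    have : c j = b + j * a - q * ((b + j * a) / (q : ℤ)) := Int.emod_def _ _
    rw [this]; push_cast; ring
  have hbx := Int.floor_le ((q : ℝ) * x)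
  have hbx' := Int.lt_floor_add_one ((q : ℝ) * x)
  rw [← hb] at hbx hbx'
  -- away from the residues `0` and `q - 1`, the approximation error cannot move the point across an
  -- integer
  have hfr : ∀ j < q, c j = 0 ∨ c j = q - 1 ∨
      ((c j : ℝ) - 1 ≤ q * Int.fract (x + j * y) ∧ q * Int.fract (x + j * y) < c j + 2) := by
    intro j hj
    by_cases h0 : c j = 0
    · exact Or.inl h0
    by_cases h1 : c j = q - 1
    · exact Or.inr (Or.inl h1)
    refine Or.inr (Or.inr ?_)
    set k : ℤ := (b + j * a) / (q : ℤ) with hk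
    have hj' : (j : ℝ) ≤ q := by exact_mod_cast hj.le
    have hθ : |(q : ℝ) * (j * y) - j * a| ≤ 1 := by
      have e : (q : ℝ) * (j * y) - j * a = q * j * (y - a / q) := by field_simp
      rw [e, abs_mul, abs_of_nonneg (by positivity)]
      calc (q : ℝ) * j * |y - a / q| ≤ q * q * (1 / (q : ℝ) ^ 2) := by gcongr
        _ = 1 := by field_simp
    rw [abs_le] at hθ
    have hcj := hdiv j
    have hc1 : (1 : ℝ) ≤ c j := by exact_mod_cast (show 1 ≤ c j by have := hc0 j; omega)
    have hc2 : (c j : ℝ) ≤ q - 2 := by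
      exact_mod_cast (show c j ≤ q - 2 by have := hcq j; omega)
    have lo : (c j : ℝ) - 1 ≤ q * (x + j * y - k) := by
      linarith [hθ.1]
    have hi : q * (x + j * y - k) < c j + 2 := by
      linarith [hθ.2]
    have hf : Int.fract (x + j * y) = x + j * y - k := by
      rw [Int.fract_eq_iff]
      refine ⟨?_, ?_, k, by ring⟩
      · exact nonneg_of_mul_nonneg_right (by linarith : 0 ≤ (q : ℝ) * (x + j * y - k)) hq'
      · refine lt_of_mul_lt_mul_left (a := (q : ℝ)) ?_ hq'.le
        linarith
    rw [hf]
    exact ⟨lo, hi⟩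
  have hqt : 0 ≤ (q : ℝ) * t := mul_nonneg hq'.le ht.1
  have hqt1 : (q : ℝ) * t ≤ q := mul_le_of_le_one_right hq'.le ht.2.le
  have up := card_filter_le_of_residue c hinj (fun j : ℕ => Int.fract (x + j * y) ≤ t) 1
    (q * t + 1) (by linarith) fun j hj hP => by
      by_cases hz : c j = 0
      · exact Or.inr (Or.inl hz)
      rcases hfr j hj with h | h | h
      · exact Or.inr (Or.inl h)
      · exact Or.inr (Or.inr h)
      · refine Or.inl ⟨by exact_mod_cast (show 1 ≤ c j by have := hc0 j; omega), ?_⟩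
        have := mul_le_mul_of_nonneg_left hP hq'.le
        linarith [h.1]
  -- the lower bound is the upper bound for the complement
  have lo := card_filter_le_of_residue c hinj (fun j : ℕ => ¬ Int.fract (x + j * y) ≤ t)
    (q * t - 2) q (by linarith) fun j hj hP => by
      rcases hfr j hj with h | h | h
      · exact Or.inr (Or.inl h)
      · exact Or.inr (Or.inr h)
      · refine Or.inl ⟨?_, by exact_mod_cast (hcq j).le⟩
        have := mul_le_mul_of_nonneg_left (not_le.1 hP).le hq'.le
        linarith [h.2]
  have htot := Finset.card_filter_add_card_filter_not (s := Finset.range q)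
    (fun j : ℕ => Int.fract (x + j * y) ≤ t)
  rw [Finset.card_range] at htot
  have htot' : (((Finset.range q).filter fun j : ℕ => Int.fract (x + j * y) ≤ t).card : ℝ)
      + ((Finset.range q).filter fun j : ℕ => ¬ Int.fract (x + j * y) ≤ t).card = q := by
    exact_mod_cast htot
  rw [abs_le]
  constructor <;> linarith

/-! ### The discrepancy of binomially weighted multiples -/

/-- The distribution function at `t ∈ [0, 1)` of the fractional part of `x + n * y`, where `n` has
the binomial distribution with parameters `N` and `1 / 2`. -/
noncomputable def binomialFractCDF (N : ℕ) (x y t : ℝ) : ℝ :=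
  ∑ n ∈ Finset.range (N + 1),
    (N.choose n : ℝ) / 2 ^ N * (if Int.fract (x + n * y) ≤ t then 1 else 0)

/-- The discrepancy bound: averaging the weighted sum over `q` shifts costs `2 * q / √N`, and the
average over a block of `q` consecutive points is within `5 / q` of `t`. -/
theorem abs_binomialFractCDF_sub_le {N : ℕ} (hN : 1 ≤ N) {y : ℝ} {a : ℤ} {q : ℕ} (hq : 0 < q)
    (haq : IsCoprime a (q : ℤ)) (hy : |y - a / q| ≤ 1 / (q : ℝ) ^ 2) (x : ℝ) {t : ℝ}
    (ht : t ∈ Set.Ico (0 : ℝ) 1) :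
    |binomialFractCDF N x y t - t| ≤ 5 / q + 2 * q / √(N : ℝ) := by
  have hq' : (0 : ℝ) < q := by exact_mod_cast hq
  set w : ℕ → ℝ := fun n => (N.choose n : ℝ) / 2 ^ N with hw
  set g : ℕ → ℝ := fun n => if Int.fract (x + n * y) ≤ t then 1 else 0 with hg
  have hg0 : ∀ n, 0 ≤ g n := fun n => by simp only [hg]; split_ifs <;> norm_num
  have hg1 : ∀ n, g n ≤ 1 := fun n => by simp only [hg]; split_ifs <;> norm_num
  have hw1 : ∑ n ∈ Finset.range (N + 1), w n = 1 := by
    simp only [hw]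
    rw [← Finset.sum_div, div_eq_one_iff_eq (by positivity)]
    exact_mod_cast Nat.sum_range_choose N
  set V : ℝ := 2 / √(N : ℝ) with hV
  have hV0 : 0 ≤ V := by positivity
  have htv : w 0 + ∑ n ∈ Finset.range (N + 1), |w n - w (n + 1)| ≤ V := by
    have e : w 0 + ∑ n ∈ Finset.range (N + 1), |w n - w (n + 1)|
        = 2 * ((N.choose (N / 2) : ℝ) / 2 ^ N) := by
      rw [← mul_div_assoc, ← choose_zero_add_sum_abs_sub, add_div, Finset.sum_div]
      simp only [hw, ← sub_div, abs_div, abs_pow, Nat.abs_ofNat]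
    rw [e, hV, div_eq_mul_one_div 2]
    exact mul_le_mul_of_nonneg_left (choose_half_div_two_pow_le hN) zero_le_two
  -- the weighted sum of the indicators shifted by `j`
  set S : ℕ → ℝ := fun j => ∑ n ∈ Finset.range (N + 1), w n * g (n + j) with hS
  have hshift : ∀ j, |S j - S 0| ≤ j * V := by
    intro j
    induction j with
    | zero => simp
    | succ j ih =>
      have h1 : |S (j + 1) - S j| ≤ V := by
        have := abs_sum_shift_sub_sum_le w (fun n => g (n + j)) N (by positivity)
          (by simp [hw]) (fun n => hg0 _) (fun n => hg1 _)
        refine le_trans (le_of_eq ?_) (this.trans htv)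
        simp only [hS, add_assoc, add_comm 1 j]
      have := abs_sub_le (S (j + 1)) (S j) (S 0)
      push_cast
      linarith
  have hav : |∑ j ∈ Finset.range q, S j - q * t| ≤ 5 := by
    have e : ∑ j ∈ Finset.range q, S j - q * t
        = ∑ n ∈ Finset.range (N + 1), w n * (∑ j ∈ Finset.range q, g (n + j) - q * t) := by
      simp only [hS, mul_sub, Finset.sum_sub_distrib, ← Finset.sum_mul, hw1, one_mul]
      rw [Finset.sum_comm]
      simp only [Finset.mul_sum]
    rw [e]
    refine (Finset.abs_sum_le_sum_abs _ _).trans ?_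
    calc _ ≤ ∑ n ∈ Finset.range (N + 1), w n * 5 := by
          refine Finset.sum_le_sum fun n _ => ?_
          have hwn : 0 ≤ w n := by positivity
          rw [abs_mul, abs_of_nonneg hwn]
          refine mul_le_mul_of_nonneg_left ?_ hwn
          have := abs_card_filter_fract_le_sub_le hq haq hy (x + n * y) ht
          rw [Finset.card_filter] at this
          push_cast at this
          simpa only [hg, Nat.cast_add, add_mul, add_assoc] using this
      _ = 5 := by rw [← Finset.sum_mul, hw1, one_mul]
  have hdiff : |∑ j ∈ Finset.range q, S j - q * S 0| ≤ q * (q * V) := by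
    have e : ∑ j ∈ Finset.range q, S j - q * S 0 = ∑ j ∈ Finset.range q, (S j - S 0) := by
      simp
    rw [e]
    refine (Finset.abs_sum_le_sum_abs _ _).trans ?_
    calc _ ≤ ∑ j ∈ Finset.range q, (q : ℝ) * V := by
          refine Finset.sum_le_sum fun j hj => (hshift j).trans ?_
          have : (j : ℝ) ≤ q := by exact_mod_cast (Finset.mem_range.1 hj).le
          gcongr
      _ = _ := by simp
  have hS0 : binomialFractCDF N x y t = S 0 := rfl
  rw [hS0]
  have hfin : (q : ℝ) * |S 0 - t| ≤ 5 + q * (q * V) := by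
    rw [← abs_of_pos hq', ← abs_mul, abs_of_pos hq']
    have := abs_sub_le (q * S 0) (∑ j ∈ Finset.range q, S j) (q * t)
    rw [abs_sub_comm ((q : ℝ) * S 0) (∑ j ∈ Finset.range q, S j)] at this
    rw [mul_sub]
    linarith
  have : 5 / q + 2 * q / √(N : ℝ) = (5 + q * (q * V)) / q := by
    rw [hV]; field_simp
  rw [this, le_div_iff₀ hq', mul_comm]
  exact hfin

/-! ### The multiset of stick lengths -/

/-- Cutting turns the pieces of stage `N` with index `n` into pieces of stage `N + 1` with indices `n`
and `n + 1`, so the multiplicities obey Pascal's rule. -/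
theorem stickLengths_eq_sum (p L : ℝ) (N : ℕ) :
    stickLengths p L N
      = ∑ n ∈ Finset.range (N + 1), N.choose n • ({pieceLength p L N n} : Multiset ℝ) := by
  induction N with
  | zero => simp [stickLengths, pieceLength]
  | succ N ih =>
    have hb : stickLengths p L (N + 1)
        = (stickLengths p L N).map (· * p) + (stickLengths p L N).map (· * (1 - p)) := by
      simp only [stickLengths, Multiset.insert_eq_cons, Multiset.bind_cons,
        Multiset.bind_singleton]
    have hm : ∀ c : ℝ, (stickLengths p L N).map (· * c) = ∑ n ∈ Finset.range (N + 1),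
        N.choose n • ({pieceLength p L N n * c} : Multiset ℝ) := by
      intro c
      rw [ih, ← Multiset.coe_mapAddMonoidHom, map_sum]
      simp only [Multiset.coe_mapAddMonoidHom, Multiset.map_nsmul, Multiset.map_singleton]
    have h1 : ∀ n ∈ Finset.range (N + 1), N.choose n • ({pieceLength p L N n * p} : Multiset ℝ)
        = N.choose n • {pieceLength p L (N + 1) n} := by
      intro n hn
      have : n ≤ N := Nat.lt_succ_iff.1 (Finset.mem_range.1 hn)
      congr 2
      rw [pieceLength, pieceLength, Nat.succ_sub this, pow_succ]; ring
    have h2 : ∀ n ∈ Finset.range (N + 1),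
        N.choose n • ({pieceLength p L N n * (1 - p)} : Multiset ℝ)
        = N.choose n • {pieceLength p L (N + 1) (n + 1)} := by
      intro n hn
      congr 2
      rw [pieceLength, pieceLength, Nat.add_sub_add_right, pow_succ]; ring
    have h3 : ∑ n ∈ Finset.range (N + 1),
          N.choose n • ({pieceLength p L (N + 1) n} : Multiset ℝ)
        = ∑ n ∈ Finset.range (N + 1),
            N.choose (n + 1) • ({pieceLength p L (N + 1) (n + 1)} : Multiset ℝ)
          + {pieceLength p L (N + 1) 0} := by
      have := Finset.sum_range_succ
        (fun n => N.choose n • ({pieceLength p L (N + 1) n} : Multiset ℝ)) (N + 1)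
      rw [Finset.sum_range_succ', Nat.choose_succ_self] at this
      simp only [zero_nsmul, add_zero, Nat.choose_zero_right, one_nsmul] at this
      exact this.symm
    rw [hb, hm, hm, Finset.sum_congr rfl h1, Finset.sum_congr rfl h2, h3,
      Finset.sum_range_succ' _ (N + 1)]
    simp only [Nat.choose_succ_succ, Nat.choose_zero_right, one_nsmul, add_nsmul,
      Finset.sum_add_distrib]
    abel

theorem card_stickLengths (p L : ℝ) (N : ℕ) : (stickLengths p L N).card = 2 ^ N := by
  rw [stickLengths_eq_sum, Multiset.card_sum]
  simp [Nat.sum_range_choose]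

theorem pieceLength_pos {p L : ℝ} (hp : p ∈ Set.Ioo (0 : ℝ) 1) (hL : 0 < L) (N n : ℕ) :
    0 < pieceLength p L N n := by
  have h0 := hp.1
  have h1 : 0 < 1 - p := sub_pos.2 hp.2
  unfold pieceLength
  positivity

theorem pieceLength_eq_mul_rpow {p L y : ℝ} (hp : p ∈ Set.Ioo (0 : ℝ) 1)
    (hy : (10 : ℝ) ^ y = (1 - p) / p) {N n : ℕ} (hn : n ≤ N) :
    pieceLength p L N n = L * p ^ N * (10 : ℝ) ^ (n * y) := by
  have h0 : p ≠ 0 := hp.1.ne'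
  rw [mul_comm (n : ℝ), Real.rpow_mul_natCast (by norm_num), hy, pieceLength, div_pow,
    ← pow_sub_mul_pow p hn]
  field_simp

theorem pieceLength_succ_div {p L y : ℝ} (hp : p ∈ Set.Ioo (0 : ℝ) 1) (hL : 0 < L)
    (hy : (10 : ℝ) ^ y = (1 - p) / p) {N n : ℕ} (hn : n < N) :
    pieceLength p L N (n + 1) / pieceLength p L N n = (10 : ℝ) ^ y := by
  have h0 := hp.1
  rw [pieceLength_eq_mul_rpow hp hy hn, pieceLength_eq_mul_rpow hp hy hn.le,
    mul_div_mul_left _ _ (by positivity), ← Real.rpow_sub (by norm_num)]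
  congr 1
  push_cast; ring

theorem pieceLength_injOn {p L y : ℝ} (hp : p ∈ Set.Ioo (0 : ℝ) 1) (hL : 0 < L)
    (hy : (10 : ℝ) ^ y = (1 - p) / p) (hp2 : p ≠ 1 / 2) (N : ℕ) :
    Set.InjOn (pieceLength p L N) (Finset.range (N + 1)) := by
  have h0 := hp.1
  have hy0 : y ≠ 0 := by
    rintro rfl
    rw [Real.rpow_zero, eq_div_iff h0.ne'] at hy
    exact hp2 (by linarith)
  intro m hm n hn h
  simp only [Finset.coe_range, Set.mem_Iio, Nat.lt_succ_iff] at hm hn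
  rw [pieceLength_eq_mul_rpow hp hy hm, pieceLength_eq_mul_rpow hp hy hn] at h
  have h1 := mul_left_cancel₀ (by positivity) h
  rw [Real.rpow_right_inj (by norm_num) (by norm_num)] at h1
  exact_mod_cast mul_right_cancel₀ hy0 h1

theorem toFinset_stickLengths (p L : ℝ) (N : ℕ) :
    (stickLengths p L N).toFinset = (Finset.range (N + 1)).image (pieceLength p L N) := by
  ext x
  rw [Multiset.mem_toFinset, stickLengths_eq_sum, Multiset.mem_sum]
  simp only [Finset.mem_image]
  refine exists_congr fun n => and_congr_right fun hn => ?_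
  have : N.choose n ≠ 0 := (Nat.choose_pos (Nat.lt_succ_iff.1 (Finset.mem_range.1 hn))).ne'
  rw [Multiset.mem_nsmul_of_ne_zero this, Multiset.mem_singleton, eq_comm]

theorem count_stickLengths {p L : ℝ} {N : ℕ}
    (hinj : Set.InjOn (pieceLength p L N) (Finset.range (N + 1))) {n : ℕ} (hn : n ≤ N) :
    (stickLengths p L N).count (pieceLength p L N n) = N.choose n := by
  have hn' : n ∈ Finset.range (N + 1) := Finset.mem_range.2 (Nat.lt_succ_iff.2 hn)
  rw [stickLengths_eq_sum, Multiset.count_sum', Finset.sum_eq_single_of_mem n hn']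
  · simp
  · intro m hm hmn
    have : pieceLength p L N n ≠ pieceLength p L N m := fun h => hmn (hinj hm hn' h.symm)
    simp [this]

/-! ### Significands and fractional parts of logarithms -/

theorem significand_le_iff {x s : ℝ} (hx : 0 < x) (hs : 0 < s) :
    significand x ≤ s ↔ Int.fract (Real.logb 10 x) ≤ Real.logb 10 s := by
  have h : significand x = (10 : ℝ) ^ Int.fract (Real.logb 10 x) := by
    rw [significand, Int.fract, Real.rpow_sub (by norm_num), Real.rpow_intCast,
      Real.rpow_logb (by norm_num) (by norm_num) hx]
  rw [h, Real.le_logb_iff_rpow_le (by norm_num) hs]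

theorem significandProportion_stickLengths {p L y : ℝ} (hp : p ∈ Set.Ioo (0 : ℝ) 1) (hL : 0 < L)
    (hy : (10 : ℝ) ^ y = (1 - p) / p) (N : ℕ) {s : ℝ} (hs : 0 < s) :
    significandProportion (stickLengths p L N) s
      = binomialFractCDF N (Real.logb 10 (L * p ^ N)) y (Real.logb 10 s) := by
  have h0 := hp.1
  have hmap : ((stickLengths p L N).map (significandIndicator s)).sum
      = ∑ n ∈ Finset.range (N + 1), (N.choose n : ℝ) * significandIndicator s
          (pieceLength p L N n) := by
    rw [stickLengths_eq_sum, ← Multiset.coe_mapAddMonoidHom, map_sum,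
      ← Multiset.coe_sumAddMonoidHom, map_sum]
    simp [Multiset.map_nsmul, Multiset.sum_nsmul]
  rw [significandProportion, hmap, card_stickLengths, binomialFractCDF, Finset.sum_div]
  refine Finset.sum_congr rfl fun n hn => ?_
  have hlog : Real.logb 10 (pieceLength p L N n) = Real.logb 10 (L * p ^ N) + n * y := by
    rw [pieceLength_eq_mul_rpow hp hy (Nat.lt_succ_iff.1 (Finset.mem_range.1 hn)),
      Real.logb_mul (by positivity) (by positivity), Real.logb_rpow (by norm_num) (by norm_num)]
  rw [significandIndicator]
  simp only [significand_le_iff (pieceLength_pos hp hL N n) hs, hlog]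
  push_cast
  ring

theorem logb_mem_Ico {s : ℝ} (hs : s ∈ Set.Ico (1 : ℝ) 10) :
    Real.logb 10 s ∈ Set.Ico (0 : ℝ) 1 :=
  ⟨Real.logb_nonneg (by norm_num) hs.1,
    (Real.logb_lt_iff_lt_rpow (by norm_num) (by linarith [hs.1])).2 (by simpa using hs.2)⟩

/-! ### Convergence to Benford's law -/

theorem exists_den_gt_of_irrational {y : ℝ} (hy : Irrational y) (K : ℕ) :
    ∃ r : ℚ, K < r.den ∧ |y - r| < 1 / (r.den : ℝ) ^ 2 := by
  obtain ⟨d, hd, hd0⟩ := (eventually_nhdsWithin_of_eventually_nhds (s := Set.Ioi 0)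
    (hy.eventually_forall_le_dist_cast_rat_of_den_le K)).and self_mem_nhdsWithin |>.exists
  obtain ⟨Q, hQ⟩ := exists_nat_gt (1 / d)
  have hQ0 : (0 : ℝ) < Q := (one_div_pos.2 hd0).trans hQ
  obtain ⟨r, hr, hrQ⟩ := Real.exists_rat_abs_sub_le_and_den_le y (Nat.cast_pos.1 hQ0)
  have hden : (1 : ℝ) ≤ r.den := by exact_mod_cast r.pos
  have hrQ' : (r.den : ℝ) ≤ Q := by exact_mod_cast hrQ
  refine ⟨r, not_le.1 fun hle => not_lt.2 (hd r hle) ?_, hr.trans_lt ?_⟩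
  · rw [Real.dist_eq]
    refine hr.trans_lt ((one_div_lt (by positivity) hd0).2 (hQ.trans ?_))
    nlinarith
  · refine one_div_lt_one_div_of_lt (by positivity) ?_
    nlinarith

/-- The starting points `x N` may depend on `N`, since the discrepancy bound is uniform in them. -/
theorem tendsto_binomialFractCDF {y : ℝ} (hy : Irrational y) (x : ℕ → ℝ) {t : ℝ}
    (ht : t ∈ Set.Ico (0 : ℝ) 1) :
    Tendsto (fun N => binomialFractCDF N (x N) y t) atTop (𝓝 t) := by
  rw [Metric.tendsto_atTop]
  intro ε hε
  obtain ⟨K, hK⟩ := exists_nat_gt (10 / ε)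
  obtain ⟨r, hrK, hr⟩ : ∃ r : ℚ, K < r.den ∧ |y - r| < 1 / (r.den : ℝ) ^ 2 :=
    exists_den_gt_of_irrational hy K
  have hden : (0 : ℝ) < r.den := by exact_mod_cast r.pos
  have hlim : Tendsto (fun N : ℕ => 2 * (r.den : ℝ) / √(N : ℝ)) atTop (𝓝 0) :=
    (tendsto_const_nhds).div_atTop (Real.tendsto_sqrt_atTop.comp tendsto_natCast_atTop_atTop)
  obtain ⟨N₀, hN₀⟩ := eventually_atTop.1 (hlim.eventually_lt_const (half_pos hε))
  refine ⟨max N₀ 1, fun N hN => ?_⟩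
  rw [Real.dist_eq]
  have h1 := abs_binomialFractCDF_sub_le ((le_max_right _ _).trans hN) r.pos
    (Rat.isCoprime_num_den r) (by rw [← Rat.cast_def]; exact hr.le) (x N) ht
  have h2 := hN₀ N ((le_max_left _ _).trans hN)
  have h3 : 5 / (r.den : ℝ) < ε / 2 := by
    have : (K : ℝ) < r.den := by exact_mod_cast hrK
    rw [div_lt_iff₀ hden]
    have := hK.trans this
    rw [div_lt_iff₀ hε] at this
    linarith
  linarith

/-- For rational `y` with denominator `b`, two values of `fract (x N + n * y)` which differ by less
than `1 / b` are equal, so for no `N` are there points in both `(0, 1 / (3 * b)]` and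
`(1 / (3 * b), 2 / (3 * b)]`, whereas the limit would give positive mass to each. -/
theorem not_tendsto_binomialFractCDF {y : ℝ} (hy : ¬ Irrational y) (x : ℕ → ℝ) :
    ¬ ∀ t ∈ Set.Ico (0 : ℝ) 1, Tendsto (fun N => binomialFractCDF N (x N) y t) atTop (𝓝 t) := by
  intro H
  obtain ⟨r, rfl⟩ : y ∈ Set.range ((↑) : ℚ → ℝ) := not_not.1 hy
  set b : ℝ := (r.den : ℝ) with hb
  have hb1 : 1 ≤ b := by rw [hb]; exact_mod_cast r.pos
  have hbpos : 0 < b := by linarith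
  have hbr : b * r = r.num := by rw [hb]; exact_mod_cast r.den_mul_eq_num
  have hclass : ∀ N m n : ℕ, ∃ k : ℤ,
      b * Int.fract (x N + m * r) - b * Int.fract (x N + n * r) = k := by
    intro N m n
    refine ⟨(m - n) * r.num - r.den * (⌊x N + m * r⌋ - ⌊x N + n * r⌋), ?_⟩
    simp only [Int.fract]
    push_cast
    rw [← hbr, ← hb]
    ring
  -- convergence forces a point into every interval `(u, v]`, for large `N`
  have hstep : ∀ u v : ℝ, u ∈ Set.Ico (0 : ℝ) 1 → v ∈ Set.Ico (0 : ℝ) 1 → u < v →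
      ∀ᶠ N in atTop, ∃ n : ℕ, u < Int.fract (x N + n * r) ∧ Int.fract (x N + n * r) ≤ v := by
    intro u v hu hv huv
    filter_upwards [(H u hu).eventually_lt (H v hv) huv] with N hN
    by_contra! hcon
    refine absurd hN (not_lt.2 (Finset.sum_le_sum fun n _ => ?_))
    refine mul_le_mul_of_nonneg_left ?_ (by positivity)
    have := hcon n
    split_ifs with h1 h2 <;> norm_num
    exact absurd (this (not_le.1 h2)) (not_lt.2 h1)
  have hm0 : (0 : ℝ) ∈ Set.Ico (0 : ℝ) 1 := by simp
  have hm1 : 1 / (3 * b) ∈ Set.Ico (0 : ℝ) 1 :=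
    ⟨by positivity, by rw [div_lt_one (by positivity)]; linarith⟩
  have hm2 : 2 / (3 * b) ∈ Set.Ico (0 : ℝ) 1 :=
    ⟨by positivity, by rw [div_lt_one (by positivity)]; linarith⟩
  obtain ⟨N, ⟨m, hm, hm'⟩, n, hn, hn'⟩ := ((hstep _ _ hm0 hm1 (by positivity)).and
    (hstep _ _ hm1 hm2 (by gcongr; norm_num))).exists
  obtain ⟨k, hk⟩ := hclass N n m
  rw [le_div_iff₀ (by positivity)] at hm' hn'
  rw [div_lt_iff₀ (by positivity)] at hn
  have hbm := mul_pos hbpos hm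
  have hk0 : (0 : ℝ) < k := by linarith
  have hk1 : (k : ℝ) < 1 := by linarith
  have : (0 : ℤ) < k := by exact_mod_cast hk0
  have : k < (1 : ℤ) := by exact_mod_cast hk1
  omega

theorem convergesToBenford_iff {p L y : ℝ} (hp : p ∈ Set.Ioo (0 : ℝ) 1) (hL : 0 < L)
    (hy : (10 : ℝ) ^ y = (1 - p) / p) :
    ConvergesToBenford (stickLengths p L) ↔ Irrational y := by
  constructor
  · intro H
    by_contra hirr
    refine not_tendsto_binomialFractCDF hirr (fun N => Real.logb 10 (L * p ^ N)) fun t ht => ?_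
    have hs : (10 : ℝ) ^ t ∈ Set.Ico (1 : ℝ) 10 :=
      ⟨Real.one_le_rpow (by norm_num) ht.1,
        by simpa using Real.rpow_lt_rpow_of_exponent_lt (by norm_num : (1 : ℝ) < 10) ht.2⟩
    have := H _ hs
    simp only [significandProportion_stickLengths hp hL hy _ (zero_lt_one.trans_le hs.1)] at this
    rwa [Real.logb_rpow (by norm_num) (by norm_num)] at this
  · intro hirr s hs
    simp only [significandProportion_stickLengths hp hL hy _ (zero_lt_one.trans_le hs.1)]
    exact tendsto_binomialFractCDF hirr _ (logb_mem_Ico hs)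

/-! ### Rate of convergence -/

/-- Beyond the irrationality exponent, rational approximation fails uniformly over all
denominators. -/
theorem exists_le_rpow_mul_abs_sub {y κ κ' : ℝ} (h : HasIrrationalityExponent y κ)
    (hκ : κ < κ') :
    ∃ c > 0, ∀ q : ℕ, 0 < q → ∀ m : ℤ, c ≤ (q : ℝ) ^ (κ' + 1) * |y - m / q| := by
  have hnot : liminf (fun q : ℕ =>
      ENNReal.ofReal ((q : ℝ) ^ (κ' + 1) * ⨅ m : ℤ, |y - (m : ℝ) / (q : ℝ)|)) atTop ≠ 0 :=
    fun h0 => not_lt.2 (h.1 h0) hκ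
  obtain ⟨d, hd0, hd⟩ := exists_between (pos_iff_ne_zero.2 hnot)
  obtain ⟨q₀, hq₀⟩ := eventually_atTop.1 (eventually_lt_of_lt_liminf hd)
  have hdtop : d ≠ ⊤ := ((hq₀ q₀ le_rfl).trans_le le_top).ne
  have hdpos : 0 < d.toReal := ENNReal.toReal_pos hd0.ne' hdtop
  have hlarge : ∀ q : ℕ, q₀ ≤ q → ∀ m : ℤ, d.toReal ≤ (q : ℝ) ^ (κ' + 1) * |y - m / q| := by
    intro q hq m
    have h1 := (ENNReal.lt_ofReal_iff_toReal_lt hdtop).1 (hq₀ q hq)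
    refine h1.le.trans (mul_le_mul_of_nonneg_left ?_ (by positivity))
    exact ciInf_le ⟨0, by rintro _ ⟨k, rfl⟩; exact abs_nonneg _⟩ m
  set Q : ℕ := q₀ + 1 with hQ
  have hQpos : (0 : ℝ) < Q := by positivity
  refine ⟨d.toReal / (Q : ℝ) ^ (κ' + 1), by positivity, fun q hq m => ?_⟩
  -- small denominators reduce to large ones through `m / q = (m * Q) / (q * Q)`
  have h2 := hlarge (q * Q) (by nlinarith) (m * Q)
  have hq' : (0 : ℝ) < q := by exact_mod_cast hq
  rw [div_le_iff₀ (by positivity)]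
  refine h2.trans (le_of_eq ?_)
  push_cast
  rw [mul_div_mul_right _ _ (by positivity), Real.mul_rpow hq'.le (by positivity)]
  ring

theorem HasIrrationalityExponent.irrational {y κ : ℝ} (h : HasIrrationalityExponent y κ) :
    Irrational y := by
  rintro ⟨r, rfl⟩
  obtain ⟨c, hc, H⟩ := exists_le_rpow_mul_abs_sub h (lt_add_one κ)
  have := H r.den r.pos r.num
  rw [← Rat.cast_def, sub_self, abs_zero, mul_zero] at this
  linarith

theorem HasIrrationalityExponent.one_le {y κ : ℝ} (h : HasIrrationalityExponent y κ) :
    1 ≤ κ := by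
  by_contra! hκ
  obtain ⟨κ', h1, h2⟩ := exists_between hκ
  obtain ⟨c, hc, H⟩ := exists_le_rpow_mul_abs_sub h h1
  have hlim : Tendsto (fun n : ℕ => (n : ℝ) ^ (-(1 - κ'))) atTop (𝓝 0) :=
    (tendsto_rpow_neg_atTop (by linarith)).comp tendsto_natCast_atTop_atTop
  obtain ⟨K, hK⟩ := eventually_atTop.1 (hlim.eventually_lt_const hc)
  obtain ⟨r, hrK, hr⟩ := exists_den_gt_of_irrational h.irrational K
  have hden : (0 : ℝ) < r.den := by exact_mod_cast r.pos
  have h3 := H r.den r.pos r.num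
  rw [← Rat.cast_def] at h3
  have h4 : (r.den : ℝ) ^ (κ' + 1) * |y - r| ≤ (r.den : ℝ) ^ (κ' + 1) * (1 / (r.den : ℝ) ^ 2) := by
    gcongr
  have h5 : (r.den : ℝ) ^ (κ' + 1) * (1 / (r.den : ℝ) ^ 2) = (r.den : ℝ) ^ (-(1 - κ')) := by
    rw [← Real.rpow_natCast, mul_one_div, ← Real.rpow_sub hden]
    congr 1; push_cast; ring
  linarith [hK r.den hrK.le]

/-- Dirichlet's theorem gives `q` with `c * N ^ η ≤ q ≤ N ^ (1 / 2 - η)`, for which the two terms of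
the discrepancy bound are both `O(N ^ (-η))`. -/
theorem exists_binomialFractCDF_rate {y κ η : ℝ} (h : HasIrrationalityExponent y κ)
    (hη : η ∈ Set.Ioo (0 : ℝ) (1 / (2 * (κ + 1)))) :
    ∃ C : ℝ, ∀ N : ℕ, 1 ≤ N → ∀ x : ℝ, ∀ t ∈ Set.Ico (0 : ℝ) 1,
      |binomialFractCDF N x y t - t| ≤ C * (N : ℝ) ^ (-η) := by
  have hκ1 := h.one_le
  have hη0 := hη.1
  obtain ⟨κ', hκ'⟩ : ∃ κ' : ℝ, κ' * η = 1 / 2 - η := ⟨(1 / 2 - η) / η, by field_simp⟩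
  -- equivalently `2 * η * (κ' + 1) = 1`, so that `κ < κ'` is the upper bound for `η`
  have hlt : κ < κ' := by
    have := (lt_div_iff₀ (by positivity)).1 hη.2
    nlinarith
  have hκ'0 : 0 < κ' := by linarith
  obtain ⟨c, hc, H⟩ := exists_le_rpow_mul_abs_sub h hlt
  refine ⟨5 * (c ^ κ'⁻¹)⁻¹ + 2, fun N hN x t ht => ?_⟩
  have hN' : (1 : ℝ) ≤ N := by exact_mod_cast hN
  have hN0 : (0 : ℝ) < N := by linarith
  set Q : ℕ := ⌊(N : ℝ) ^ (κ' * η)⌋₊ with hQ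
  have hQ1 : 0 < Q := Nat.floor_pos.2 (Real.one_le_rpow hN' (by positivity))
  obtain ⟨r, hr, hrQ⟩ := Real.exists_rat_abs_sub_le_and_den_le y hQ1
  have hden : (0 : ℝ) < r.den := by exact_mod_cast r.pos
  have hrQ' : (r.den : ℝ) ≤ Q := by exact_mod_cast hrQ
  have hsq : |y - r| ≤ 1 / (r.den : ℝ) ^ 2 := by
    refine hr.trans (one_div_le_one_div_of_le (by positivity) ?_)
    rw [sq]; gcongr; linarith
  have hmain := abs_binomialFractCDF_sub_le hN r.pos (Rat.isCoprime_num_den r)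
    (by rw [← Rat.cast_def]; exact hsq) x ht
  have hup : (r.den : ℝ) ≤ (N : ℝ) ^ (κ' * η) := hrQ'.trans (Nat.floor_le (by positivity))
  -- the lower bound for `|y - r|`, with `κ'`, against Dirichlet's upper bound
  have hlow : c ^ κ'⁻¹ * (N : ℝ) ^ η ≤ r.den := by
    have h1 := H r.den r.pos r.num
    rw [← Rat.cast_def] at h1
    have h2 : c ≤ (r.den : ℝ) ^ (κ' + 1) * (1 / ((Q + 1) * r.den)) :=
      h1.trans (mul_le_mul_of_nonneg_left hr (by positivity))
    rw [Real.rpow_add_one hden.ne', mul_one_div, mul_div_mul_right _ _ hden.ne',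
      le_div_iff₀ (by positivity)] at h2
    have h3 : c * (N : ℝ) ^ (κ' * η) ≤ (r.den : ℝ) ^ κ' :=
      (mul_le_mul_of_nonneg_left (Nat.lt_floor_add_one _).le hc.le).trans h2
    have h4 := Real.rpow_le_rpow (by positivity) h3 (inv_nonneg.2 hκ'0.le)
    rw [Real.mul_rpow hc.le (by positivity), ← Real.rpow_mul hN0.le, ← Real.rpow_mul hden.le,
      mul_inv_cancel₀ hκ'0.ne', Real.rpow_one] at h4
    rwa [show κ' * η * κ'⁻¹ = η by field_simp] at h4
  have e1 : 5 / (r.den : ℝ) ≤ 5 * (c ^ κ'⁻¹)⁻¹ * (N : ℝ) ^ (-η) := by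
    calc 5 / (r.den : ℝ) ≤ 5 / (c ^ κ'⁻¹ * (N : ℝ) ^ η) := by gcongr
      _ = _ := by rw [Real.rpow_neg hN0.le]; field_simp
  have e2 : 2 * (r.den : ℝ) / √(N : ℝ) ≤ 2 * (N : ℝ) ^ (-η) := by
    rw [Real.sqrt_eq_rpow, div_le_iff₀ (by positivity), mul_assoc, ← Real.rpow_add hN0,
      show -η + 1 / 2 = κ' * η by linarith]
    gcongr
  rw [add_mul]
  linarith

theorem theorem1p9 (p L y : ℝ) (hp : p ∈ Set.Ioo (0 : ℝ) 1) (hL : 0 < L)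
    (hy : (10 : ℝ) ^ y = (1 - p) / p) :
    -- the stick lengths after `N` stages, their frequencies and the ratio of adjacent lengths
    (∀ N : ℕ,
      (stickLengths p L N).card = 2 ^ N ∧
      stickLengths p L N
        = ∑ n ∈ Finset.range (N + 1), N.choose n • ({pieceLength p L N n} : Multiset ℝ) ∧
      (p ≠ 1 / 2 →
        (stickLengths p L N).toFinset.card = N + 1 ∧
        ∀ n ≤ N, ((stickLengths p L N).count (pieceLength p L N n) : ℝ)
          / ((stickLengths p L N).card : ℝ) = (N.choose n : ℝ) / 2 ^ N) ∧
      ∀ n < N, pieceLength p L N (n + 1) / pieceLength p L N n = (10 : ℝ) ^ y) ∧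
    -- convergence to Benford's law
    (ConvergesToBenford (stickLengths p L) ↔ Irrational y) ∧
    -- power saving when the irrationality exponent is finite
    (∀ κ : ℝ, HasIrrationalityExponent y κ →
      1 ≤ κ ∧
      ∀ η ∈ Set.Ioo (0 : ℝ) (1 / (2 * (κ + 1))), ∃ C : ℝ, ∀ N : ℕ, 1 ≤ N →
        ∀ s ∈ Set.Ico (1 : ℝ) 10,
          |significandProportion (stickLengths p L N) s - Real.logb 10 s|
            ≤ C * (N : ℝ) ^ (-η)) := by
  refine ⟨fun N => ⟨card_stickLengths p L N, stickLengths_eq_sum p L N, fun hp2 => ?_,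
    fun n hn => pieceLength_succ_div hp hL hy hn⟩, convergesToBenford_iff hp hL hy,
    fun κ hκ => ⟨hκ.one_le, fun η hη => ?_⟩⟩
  · have hinj := pieceLength_injOn hp hL hy hp2 N
    refine ⟨?_, fun n hn => ?_⟩
    · rw [toFinset_stickLengths, Finset.card_image_of_injOn hinj, Finset.card_range]
    · rw [count_stickLengths hinj hn, card_stickLengths]
      push_cast
      rfl
  · obtain ⟨C, hC⟩ := exists_binomialFractCDF_rate hκ hη
    refine ⟨C, fun N hN s hs => ?_⟩
    rw [significandProportion_stickLengths hp hL hy N (zero_lt_one.trans_le hs.1)]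
    exact hC N hN _ _ (logb_mem_Ico hs)
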